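/- Let $p$ be a prime, $K=\mathbb{Q}(\mu_p)$, $G=\mathrm{Gal}(K/\mathbb{Q})$, and let $\mathfrak p$ be the unique prime ideal of $K$ above $p$. Let $\omega : G\to\mu_{p-1}(\mathbb{Q}_p)\subset\mathbb{Z}_p^\times$ be the Teichmüller character ($\zeta^s=\zeta^{\omega(s)}$ for $\zeta\in\mu_p$ and $s\in G$), let $\theta=\omega^m$ with $2\le m\le p-2$, and let $e_\theta=\frac{1}{p-1}\sum_{s\in G}\theta(s^{-1})\,s\in\mathbb{Z}_p[G]$. For $x\in K^\times$ and an integral ideal $I$ that is a power of $\mathfrak p$, write $x\equiv 1 \pmod I$ if $x-1$ lies in $I$ localized at $\mathfrak p$. An element $x\in K^\times$ prime to $p$ is called $p$-primary if $K(\sqrt[p]{x})/K$ is unramified at $\mathfrak p$. Let $\alpha\in K^\times$ with $\alpha\equiv 1\pmod{\mathfrak p}$, and let $N\ge 1$ be an integer. If $e\in\mathbb{Z}[G]$ and $e\equiv e_\theta\pmod{p^N\mathbb{Z}_p[G]}$, then $\alpha^{e}\equiv 1\pmod{\mathfrak p}$. More generally, let $\alpha_\theta\in K^\times$ be any representative of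 the class of $\alpha^{e_\theta}$ in $K^\times/(K^{\times})^{p^N}$, that is, $\alpha_\theta=\alpha^{e}x^{p^N}$ with such an $e$ and some $x\in K^\times$, and suppose that it is normalized by $\alpha_\theta\equiv1\pmod{\mathfrak p}$. Then: (1) $\alpha_\theta\equiv 1\pmod{\mathfrak p^m}$; (2) $\alpha_\theta$ is $p$-primary if and only if $\alpha_\theta\equiv 1\pmod{p}$; (3) if $N\ge 2$ or $m=2$, and $\alpha_\theta$ is $p$-primary, then $\alpha_\theta\equiv 1\pmod{\mathfrak p^{m+p-1}}$, where $\mathfrak p^{m+p-1}=(p)\,\mathfrak p^m$. -/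

import Mathlib

open NumberField Polynomial

section Defs

variable (p : ℕ) [Fact p.Prime]

/-- A ring homomorphism `ℤ_p → 𝔽_p` is unique: it is the reduction modulo `p`. -/
theorem padicInt_toZMod_eq (f : ℤ_[p] →+* ZMod p) (x : ℤ_[p]) : f x = PadicInt.toZMod x := by
  have hx : x - (PadicInt.zmodRepr x : ℤ_[p]) ∈ Ideal.span {(p : ℤ_[p])} := by
    rw [← PadicInt.maximalIdeal_eq_span_p]
    exact PadicInt.sub_zmodRepr_mem x
  obtain ⟨y, hy⟩ := Ideal.mem_span_singleton.1 hx
  have h1 : x = (PadicInt.zmodRepr x : ℤ_[p]) + p * y := by rw [← hy]; ring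
  rw [h1]
  simp

variable (K : Type*) [Field K] [NumberField K] [IsCyclotomicExtension {p} ℚ K]

/-- The Teichmüller character `ω : G → ℤ_pˣ ⊆ ℤ_p` of `G = Gal(K/ℚ)`, `K = ℚ(μ_p)`: if `s`
raises `p`-th roots of unity to the power `a ∈ (ℤ/p)ˣ`, then `ω s` is the Teichmüller
representative of `a` in `ℤ_p`, the ring of Witt vectors of `𝔽_p`. -/
noncomputable def teichmullerChar : (K ≃ₐ[ℚ] K) →* ℤ_[p] :=
  ((WittVector.equiv p : WittVector p (ZMod p) →* ℤ_[p]).comp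
      (WittVector.teichmuller p)).comp
    ((Units.coeHom (ZMod p)).comp
      ((IsCyclotomicExtension.zeta_spec p ℚ K).autToPow ℚ))

/-- `ω` takes its values in the group `μ_{p-1}` of `(p-1)`-st roots of unity. -/
theorem teichmullerChar_pow (s : K ≃ₐ[ℚ] K) : teichmullerChar p K s ^ (p - 1) = 1 := by
  rw [← map_pow]
  simp only [teichmullerChar, MonoidHom.comp_apply, map_pow]
  rw [← map_pow, ← map_pow, ← map_pow, ZMod.units_pow_card_sub_one_eq_one]
  simp

/-- `ζ^s = ζ^{ω(s)}` for every `p`-th root of unity `ζ`. -/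
theorem teichmullerChar_spec (s : K ≃ₐ[ℚ] K) (ζ : K) (hζ : ζ ^ p = 1) :
    s ζ = ζ ^ (PadicInt.toZMod (teichmullerChar p K s)).val := by
  have h1 : PadicInt.toZMod (teichmullerChar p K s) =
      (((IsCyclotomicExtension.zeta_spec p ℚ K).autToPow ℚ s : (ZMod p)ˣ) : ZMod p) := by
    rw [← padicInt_toZMod_eq p (WittVector.constantCoeff.comp
      ((WittVector.equiv p).symm : ℤ_[p] →+* WittVector p (ZMod p)))]
    simp [teichmullerChar, WittVector.teichmuller_coeff_zero]
  rw [h1]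
  obtain ⟨i, -, rfl⟩ := (IsCyclotomicExtension.zeta_spec p ℚ K).eq_pow_of_pow_eq_one hζ
  rw [map_pow, ← IsPrimitiveRoot.autToPow_spec ℚ (IsCyclotomicExtension.zeta_spec p ℚ K) s,
    ← pow_mul, ← pow_mul, mul_comm]

/-- The idempotent `e_θ = (1/(p-1)) ∑_{s ∈ G} θ(s⁻¹) s` of `ℤ_p[G]`
(`p - 1` is a unit of `ℤ_p`). -/
noncomputable def idempotentOf (θ : (K ≃ₐ[ℚ] K) →* ℤ_[p]) : MonoidAlgebra ℤ_[p] (K ≃ₐ[ℚ] K) :=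
  ∑ s : K ≃ₐ[ℚ] K, MonoidAlgebra.single s (Ring.inverse ((p : ℤ_[p]) - 1) * θ s⁻¹)

/-- `e ∈ ℤ[G]` approximates `e_θ` modulo `p ^ N`: `e ≡ e_θ (mod p ^ N ℤ_p[G])`. -/
def ApproximatesIdempotent (θ : (K ≃ₐ[ℚ] K) →* ℤ_[p]) (N : ℕ)
    (e : MonoidAlgebra ℤ (K ≃ₐ[ℚ] K)) : Prop :=
  ∃ f : MonoidAlgebra ℤ_[p] (K ≃ₐ[ℚ] K),
    MonoidAlgebra.mapRingHom (K ≃ₐ[ℚ] K) (Int.castRingHom ℤ_[p]) e =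
      idempotentOf p K θ + (p : ℤ_[p]) ^ N • f

variable {K}

/-- The action of the group ring on `K ˣ`, written exponentially:
`α ^ e = ∏_s s(α) ^ {n_s}` for `e = ∑_s n_s s ∈ ℤ[G]`. -/
noncomputable def galoisPow (α : Kˣ) (e : MonoidAlgebra ℤ (K ≃ₐ[ℚ] K)) : Kˣ :=
  ∏ s : K ≃ₐ[ℚ] K, (s • α) ^ e.coeff s

/-- `β` is a `θ`-component of `α` modulo `p ^ N`-th powers: a representative in `K ˣ` of the class
`α ^ {e_θ} ∈ K ˣ / K ˣ ^ {p ^ N}`, where `e_θ` acts through its reduction modulo `p ^ N`. -/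
def IsThetaComponent (θ : (K ≃ₐ[ℚ] K) →* ℤ_[p]) (N : ℕ) (α β : Kˣ) : Prop :=
  ∃ e : MonoidAlgebra ℤ (K ≃ₐ[ℚ] K), ApproximatesIdempotent p K θ N e ∧
    ∃ x : Kˣ, β = galoisPow α e * x ^ p ^ N

/-- The congruence `x ≡ 1 (mod I)` in `K`, localized at the prime `𝔭`: `x - 1` lies in `I 𝓞_𝔭`,
where `𝓞_𝔭 ⊆ K` is the localization of the ring of integers at `𝔭`. -/
def CongrOne (𝔭 I : Ideal (𝓞 K)) (x : Kˣ) : Prop :=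
  ∃ a ∈ I, ∃ b : 𝓞 K, b ∉ 𝔭 ∧ (b : K) * ((x : K) - 1) = (a : K)

/-- `α` (prime to `p`) is `p`-primary: the Kummer extension `K(α ^ {1/p}) / K`, i.e. the splitting
field of `X ^ p - α` over `K ∋ ζ_p`, is unramified at the prime `𝔭` above `p`. -/
def IsPPrimary (𝔭 : Ideal (𝓞 K)) (α : Kˣ) : Prop :=
  Algebra.IsUnramifiedIn (𝓞 (X ^ p - C (α : K) : K[X]).SplittingField) 𝔭

end Defs

/-! Write `U_k` for the units congruent to 1 modulo `𝔭 ^ k`, and `π = ζ - 1`. For `k ≥ 1`, `G` acts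
on `U_k / U_{k+1} ≅ 𝔭 ^ k / 𝔭 ^ (k+1)` through `ω ^ k` mod `p`, since `σ π ≡ g π` mod `𝔭 ^ 2` and
the residue field is `𝔽_p`. On the other hand `σ e_θ = θ(σ) e_θ` gives `σ β = β ^ a * z ^ (p ^ N)`
with `a ≡ θ(σ)` mod `p ^ N` and `z ∈ U_1`. If `z ^ (p ^ N) ∈ U_{k+1}`, then `β ∈ U_k` lies in
`U_{k+1}` unless `k ≡ m` mod `p - 1` (`IsThetaComponent.mem_higherUnits_succ`).

The level reached by `z ^ (p ^ N)` limits the argument: it is `p + 1` for `N ≥ 1` and `2p` for `N ≥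
2`. Within it, `β` climbs from level 1 to `m`, from `p - 1` to `p`, and from `p` to `m + p - 1`.
Since `(p) = 𝔭 ^ (p-1)`, the theorem follows from the local Kummer criterion that a principal unit
is `p`-primary exactly when it lies in `U_p` (`isPPrimary_iff_mem_higherUnits`). -/

section Valuation

/-! ### Higher unit groups of a discrete valuation and `p`-th powers -/

open WithZero

variable {L : Type*} [Field L] (w : Valuation L ℤᵐ⁰)

/-- The `p`-th power of `1 + t` for an integral element `t`. -/
theorem Valuation.exists_one_add_pow_prime_eq {p : ℕ} (hp : p.Prime) {t : L} (ht : w t ≤ 1) :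
    ∃ r : L, w r ≤ 1 ∧ (1 + t) ^ p = 1 + t ^ p + p * t * r := by
  obtain ⟨r, hr⟩ := exists_add_pow_prime_eq hp 1 (⟨t, ht⟩ : w.integer)
  refine ⟨r, r.2, ?_⟩
  simpa using congrArg Subtype.val hr

theorem Valuation.map_natCast_le_one (n : ℕ) : w n ≤ 1 := (n : w.integer).2

theorem Valuation.map_intCast_le_one (n : ℤ) : w n ≤ 1 := (n : w.integer).2

/-- Injectivity of Frobenius in residue characteristic `p`: `t ^ p ≡ (1 + t) ^ p - 1`. -/
theorem Valuation.map_lt_one_of_one_add_pow_prime {p : ℕ} (hp : p.Prime) (hwp : w p < 1)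
    {t : L} (ht : w t ≤ 1) (h : w ((1 + t) ^ p - 1) < 1) : w t < 1 := by
  obtain ⟨r, hr, he⟩ := w.exists_one_add_pow_prime_eq hp ht
  have h1 : w (p * t * r) < 1 := by
    rw [map_mul, map_mul]
    exact mul_lt_one_of_lt_of_le (mul_lt_one_of_lt_of_le hwp ht) hr
  have h2 : t ^ p = ((1 + t) ^ p - 1) - p * t * r := by rw [he]; ring
  have h3 : w t ^ p < 1 := by
    rw [← map_pow, h2]
    exact w.map_sub_lt h h1
  exact lt_of_not_ge fun h4 => (not_lt_of_ge (one_le_pow_of_one_le' h4 p)) h3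

/-- In `(1 + t) ^ p - 1 = t ^ p + p t r` the two terms have order at least `p k` and `p - 1 + k`. -/
theorem Valuation.one_add_pow_prime_sub_one_le {p k n : ℕ} (hp : p.Prime)
    (hwp : w p ≤ exp (-((p - 1 : ℕ) : ℤ))) {t : L} (ht : w t ≤ exp (-(k : ℤ)))
    (h1 : n ≤ p * k) (h2 : n ≤ p - 1 + k) : w ((1 + t) ^ p - 1) ≤ exp (-(n : ℤ)) := by
  have ht1 : w t ≤ 1 := ht.trans (by rw [← exp_zero, exp_le_exp]; omega)
  obtain ⟨r, hr, he⟩ := w.exists_one_add_pow_prime_eq hp ht1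
  have h3 : (1 + t) ^ p - 1 = t ^ p + p * t * r := by rw [he]; ring
  rw [h3]
  refine w.map_add_le ?_ ?_
  · rw [map_pow]
    refine (pow_le_pow_left' ht p).trans ?_
    rw [← exp_nsmul, exp_le_exp, nsmul_eq_mul]
    have : (n : ℤ) ≤ p * k := by exact_mod_cast h1
    linarith
  · rw [map_mul, map_mul]
    refine (mul_le_mul' (mul_le_mul' hwp ht) hr).trans ?_
    rw [mul_one, ← exp_add, exp_le_exp]
    omega

/-- The binomial expansion to first order. -/
theorem Valuation.one_add_pow_sub_le {t : L} (ht : w t ≤ 1) (n : ℕ) :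
    w ((1 + t) ^ n - 1 - n * t) ≤ w t ^ 2 := by
  induction n with
  | zero => simp
  | succ n ih =>
    have h : (1 + t) ^ (n + 1) - 1 - (n + 1 : ℕ) * t =
        ((1 + t) ^ n - 1 - n * t) * (1 + t) + n * t ^ 2 := by push_cast; ring
    rw [h]
    refine w.map_add_le ?_ ?_
    · rw [map_mul]
      exact mul_le_of_le_of_le_one ih (w.map_add_le (by simp) ht)
    · rw [map_mul, map_pow]
      exact mul_le_of_le_one_left' (w.map_natCast_le_one n)

theorem Valuation.map_eq_one_of_sub_one_lt {x : L} (hx : w (x - 1) < 1) : w x = 1 := by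
  have := w.map_add_eq_of_lt_right (x := x - 1) (y := 1) (by simpa using hx)
  simpa using this

/-- The `k`-th group of higher units of a discrete valuation. -/
def Valuation.higherUnits (k : ℕ) : Subgroup Lˣ where
  -- For `k ≥ 1` the second condition implies the first; for `k = 0` the first is what makes the set
  -- closed under inverses.
  carrier := {x | w x = 1 ∧ w ((x : L) - 1) ≤ exp (-(k : ℤ))}
  one_mem' := by simp
  mul_mem' := by
    rintro x y ⟨hx, hx'⟩ ⟨hy, hy'⟩
    refine ⟨by simp [hx, hy], ?_⟩
    have h : ((x * y : Lˣ) : L) - 1 = x * (y - 1) + (x - 1) := by push_cast; ring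
    rw [h]
    refine w.map_add_le ?_ hx'
    rwa [map_mul, hx, one_mul]
  inv_mem' := by
    rintro x ⟨hx, hx'⟩
    refine ⟨by simp [hx], ?_⟩
    have h : ((x⁻¹ : Lˣ) : L) - 1 = - ((x⁻¹ : Lˣ) * (x - 1)) := by
      rw [mul_sub, Units.inv_mul]; ring
    rw [h, Valuation.map_neg, map_mul]
    simpa [hx] using hx'

theorem Valuation.mem_higherUnits {k : ℕ} {x : Lˣ} :
    x ∈ w.higherUnits k ↔ w x = 1 ∧ w ((x : L) - 1) ≤ exp (-(k : ℤ)) := Iff.rfl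

theorem Valuation.mem_higherUnits_of_le {k : ℕ} (hk : 1 ≤ k) {x : Lˣ}
    (hx : w ((x : L) - 1) ≤ exp (-(k : ℤ))) : x ∈ w.higherUnits k := by
  refine ⟨w.map_eq_one_of_sub_one_lt (hx.trans_lt ?_), hx⟩
  rw [← exp_zero, exp_lt_exp]
  omega

theorem Valuation.higherUnits_anti {j k : ℕ} (h : j ≤ k) :
    w.higherUnits k ≤ w.higherUnits j := fun _ hx => ⟨hx.1, hx.2.trans (by
  rw [exp_le_exp]; omega)⟩

theorem Valuation.lt_one_iff_le_exp_neg_one {x : L} : w x < 1 ↔ w x ≤ exp (-1 : ℤ) := by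
  rcases eq_or_ne (w x) 0 with h | h
  · simp [h]
  · rw [← exp_log h, ← exp_zero, exp_lt_exp, exp_le_exp]
    omega

theorem Valuation.pow_prime_mem_higherUnits {p k n : ℕ} (hp : p.Prime)
    (hwp : w p ≤ exp (-((p - 1 : ℕ) : ℤ))) (h1 : n ≤ p * k) (h2 : n ≤ p - 1 + k) {x : Lˣ}
    (hx : x ∈ w.higherUnits k) : x ^ p ∈ w.higherUnits n := by
  refine ⟨by simp [hx.1], ?_⟩
  have := w.one_add_pow_prime_sub_one_le hp hwp hx.2 h1 h2
  simpa using this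

theorem Valuation.mem_higherUnits_one_of_pow_prime {p : ℕ} (hp : p.Prime) (hwp : w p < 1) {x : Lˣ}
    (hx : x ^ p ∈ w.higherUnits 1) : x ∈ w.higherUnits 1 := by
  have h1 : w x = 1 := by
    have h := hx.1
    rw [Units.val_pow_eq_pow_val, map_pow] at h
    exact (pow_eq_one_iff.1 h).resolve_right hp.ne_zero
  refine ⟨h1, ?_⟩
  have h2 := hx.2
  simp only [Nat.cast_one] at h2 ⊢
  rw [← w.lt_one_iff_le_exp_neg_one] at h2 ⊢
  refine w.map_lt_one_of_one_add_pow_prime hp hwp ?_ (by simpa using h2)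
  exact w.map_sub_le h1.le (by simp)

theorem Valuation.mem_higherUnits_one_of_pow_prime_pow {p : ℕ} (hp : p.Prime) (hwp : w p < 1)
    {x : Lˣ} {N : ℕ} (hx : x ^ p ^ N ∈ w.higherUnits 1) : x ∈ w.higherUnits 1 := by
  induction N with
  | zero => simpa using hx
  | succ N ih =>
    rw [pow_succ, pow_mul] at hx
    exact ih (w.mem_higherUnits_one_of_pow_prime hp hwp hx)

end Valuation

/-! ### The prime above `p` in the cyclotomic field -/

section Cyclotomic

open WithZero IsDedekindDomain

variable {p : ℕ} [Fact p.Prime] {K : Type*} [Field K] [NumberField K]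
  [IsCyclotomicExtension {p} ℚ K] {ζ : K} (hζ : IsPrimitiveRoot ζ p)

include hζ in
theorem eq_span_zeta_sub_one_of_natCast_mem (𝔭 : Ideal (𝓞 K)) [𝔭.IsPrime] (h𝔭 : (p : 𝓞 K) ∈ 𝔭) :
    𝔭 = Ideal.span {hζ.toInteger - 1} := by
  have : 𝔭.LiesOver (Ideal.span {(p : ℤ)}) := by
    have hm : (Ideal.span {(p : ℤ)}).IsMaximal :=
      Int.ideal_span_isMaximal_of_prime p
    refine ⟨hm.eq_of_le (Ideal.comap_ne_top _ (Ideal.IsPrime.ne_top inferInstance)) ?_⟩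
    rw [Ideal.span_singleton_le_iff_mem]
    simpa [Ideal.mem_comap] using h𝔭
  exact IsCyclotomicExtension.Rat.eq_span_zeta_sub_one_of_liesOver' p K hζ 𝔭

variable {v : HeightOneSpectrum (𝓞 K)} (hv : v.asIdeal = Ideal.span {hζ.toInteger - 1})

include hv

omit [NumberField K] [IsCyclotomicExtension {p} ℚ K] in
theorem span_natCast_eq_pow : Ideal.span {(p : 𝓞 K)} = v.asIdeal ^ (p - 1) := by
  rw [hv, Ideal.span_singleton_pow, Ideal.span_singleton_eq_span_singleton]
  exact (IsCyclotomicExtension.Rat.associated_zeta_sub_one_pow_prime p hζ).symm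

theorem valuation_zeta_sub_one : v.valuation K (ζ - 1) = exp (-1 : ℤ) := by
  have h := HeightOneSpectrum.intValuation_singleton v
    hζ.zeta_sub_one_prime'.ne_zero hv
  rw [← h, ← v.valuation_of_algebraMap (K := K)]
  congr 1

omit [IsCyclotomicExtension {p} ℚ K] in
theorem valuation_natCast_prime_le : v.valuation K p ≤ exp (-((p - 1 : ℕ) : ℤ)) := by
  have h : (p : 𝓞 K) ∈ v.asIdeal ^ (p - 1) := by
    rw [← span_natCast_eq_pow hζ hv]
    exact Ideal.mem_span_singleton_self _
  rw [← v.intValuation_le_pow_iff_mem, ← v.valuation_of_algebraMap (K := K)] at h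
  simpa using h

omit [IsCyclotomicExtension {p} ℚ K] in
theorem valuation_natCast_prime_lt_one : v.valuation K p < 1 := by
  refine (valuation_natCast_prime_le hζ hv).trans_lt ?_
  rw [← exp_zero, exp_lt_exp]
  have := (Fact.out : p.Prime).two_le
  omega

theorem valuation_intCast_lt_one_iff (n : ℤ) : v.valuation K n < 1 ↔ (p : ℤ) ∣ n := by
  have h := v.valuation_lt_one_iff_mem (K := K) (n : 𝓞 K)
  rw [hv, Ideal.mem_span_singleton,
    IsCyclotomicExtension.Rat.zeta_sub_one_dvd_intCast_iff' p hζ] at h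
  simpa using h

/-- The norm of `ζ - 1` is `p`, so the residue field is `𝔽_p` and integers represent all its
classes. -/
theorem exists_intCast_sub_mem (c : 𝓞 K) : ∃ n : ℤ, c - n ∈ v.asIdeal := by
  have hp : p.Prime := Fact.out
  have hc : Nat.card (𝓞 K ⧸ v.asIdeal) = p := by
    have := IsCyclotomicExtension.Rat.absNorm_span_zeta_sub_one p 0 (K := K) (ζ := ζ)
      (hK := by simpa using ‹IsCyclotomicExtension {p} ℚ K›) (by simpa using hζ)
    rw [← hv, Ideal.absNorm_apply, Submodule.cardQuot_apply] at this
    exact this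
  have : Finite (𝓞 K ⧸ v.asIdeal) := Nat.finite_of_card_ne_zero (by rw [hc]; exact hp.ne_zero)
  have := Fintype.ofFinite (𝓞 K ⧸ v.asIdeal)
  let f := ZMod.ringEquivOfPrime (𝓞 K ⧸ v.asIdeal) hp (by rw [← Nat.card_eq_fintype_card, hc])
  obtain ⟨n, hn⟩ := ZMod.intCast_surjective (f.symm (Ideal.Quotient.mk _ c))
  refine ⟨n, ?_⟩
  rw [← Ideal.Quotient.mk_eq_mk_iff_sub_mem, map_intCast, ← map_intCast f, hn,
    RingEquiv.apply_symm_apply]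

theorem exists_intCast_valuation_sub_lt_one {x : K} (hx : v.valuation K x ≤ 1) :
    ∃ n : ℤ, v.valuation K (x - n) < 1 := by
  obtain ⟨a, ha⟩ := v.exists_valuation_sub_lt_of_integer hx 1
  obtain ⟨n, hn⟩ := exists_intCast_sub_mem hζ hv a
  refine ⟨n, ?_⟩
  have h : x - n = (algebraMap (𝓞 K) K (a - n)) - (algebraMap (𝓞 K) K a - x) := by
    rw [map_sub, map_intCast]; ring
  rw [h]
  exact (v.valuation K).map_sub_lt ((v.valuation_lt_one_iff_mem _).2 hn) (by simpa using ha)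

theorem congrOne_pow_iff {k : ℕ} {x : Kˣ} :
    CongrOne v.asIdeal (v.asIdeal ^ k) x ↔ v.valuation K ((x : K) - 1) ≤ exp (-(k : ℤ)) := by
  constructor
  · rintro ⟨a, ha, b, hb, h⟩
    have h1 : v.valuation K (b : K) = 1 := v.valuation_eq_one_iff_notMem.2 hb
    rw [← v.intValuation_le_pow_iff_mem, ← v.valuation_of_algebraMap (K := K)] at ha
    rw [← one_mul (v.valuation K ((x : K) - 1)), ← h1, ← map_mul, h]
    exact ha
  · intro h
    have hπ : v.valuation K ((ζ - 1) ^ k) = exp (-(k : ℤ)) := by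
      rw [map_pow, valuation_zeta_sub_one hζ hv, ← exp_nsmul]; simp
    have hπ0 : (ζ - 1) ^ k ≠ 0 :=
      pow_ne_zero k (hζ.sub_one_ne_zero (Fact.out : p.Prime).one_lt)
    have h1 : v.valuation K (((x : K) - 1) / (ζ - 1) ^ k) ≤ 1 := by
      rw [map_div₀, hπ]
      exact div_le_one_of_le₀ h zero_le
    obtain ⟨n, ⟨d, hd⟩, hnd⟩ := v.exists_primeCompl_mul_eq_of_integer _ h1
    refine ⟨(hζ.toInteger - 1) ^ k * n, ?_, d, hd, ?_⟩
    · rw [hv]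
      exact Ideal.mul_mem_right _ _ (Ideal.pow_mem_pow (Ideal.mem_span_singleton_self _) k)
    · change algebraMap (𝓞 K) K d * _ = algebraMap (𝓞 K) K _
      have hc : algebraMap (𝓞 K) K hζ.toInteger = ζ := rfl
      rw [map_mul, ← hnd, map_pow, map_sub, map_one, hc]
      field_simp

theorem congrOne_iff_mem_higherUnits {k : ℕ} (hk : 1 ≤ k) {x : Kˣ} :
    CongrOne v.asIdeal (v.asIdeal ^ k) x ↔ x ∈ (v.valuation K).higherUnits k :=
  (congrOne_pow_iff hζ hv).trans ⟨(v.valuation K).mem_higherUnits_of_le hk, fun h => h.2⟩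

/-- Up to a root of unity, a principal unit is trivial modulo `𝔭 ^ 2`. -/
theorem exists_mul_zeta_pow_mem_higherUnits_two {x : Kˣ}
    (hx : x ∈ (v.valuation K).higherUnits 1) :
    ∃ y ∈ (v.valuation K).higherUnits 2, y ^ p = x ^ p := by
  have hp : p.Prime := Fact.out
  set w := v.valuation K
  have hπ := valuation_zeta_sub_one hζ hv
  have hπ0 : ζ - 1 ≠ 0 := hζ.sub_one_ne_zero hp.one_lt
  obtain ⟨n, hn⟩ := exists_intCast_valuation_sub_lt_one hζ hv
    (x := ((x : K) - 1) / (ζ - 1)) (by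
      rw [map_div₀, hπ]
      exact div_le_one_of_le₀ hx.2 zero_le)
  -- Modulo `𝔭 ^ 2`, `x ≡ 1 + n π` and `ζ ^ i ≡ 1 + i π`; the choice `i ≡ -n` mod `p` cancels the
  -- linear term.
  obtain ⟨i, hi⟩ : ∃ i : ℕ, (p : ℤ) ∣ n + i := by
    refine ⟨((-n) % p).toNat, ?_⟩
    have hp0 : (p : ℤ) ≠ 0 := by exact_mod_cast hp.ne_zero
    rw [Int.toNat_of_nonneg (Int.emod_nonneg _ hp0)]
    have := Int.emod_add_mul_ediv (-n) p
    exact ⟨-((-n) / p), by linarith⟩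
  refine ⟨x * (Units.mk0 ζ (hζ.ne_zero hp.ne_zero)) ^ i,
    w.mem_higherUnits_of_le one_le_two ?_, ?_⟩
  · have hn' : w (x - 1 - n * (ζ - 1)) ≤ exp (-(2 : ℤ)) := by
      have h : (x : K) - 1 - n * (ζ - 1) = (((x : K) - 1) / (ζ - 1) - n) * (ζ - 1) := by
        field_simp
      rw [h, map_mul, hπ]
      refine (mul_le_mul_left (w.lt_one_iff_le_exp_neg_one.1 hn) _).trans ?_
      rw [← exp_add, exp_le_exp]; norm_num
    have hi' : w ((n + i : ℤ) * (ζ - 1)) ≤ exp (-(2 : ℤ)) := by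
      rw [map_mul, hπ]
      have := (valuation_intCast_lt_one_iff hζ hv _).2 hi
      refine (mul_le_mul_left (w.lt_one_iff_le_exp_neg_one.1 this) _).trans ?_
      rw [← exp_add, exp_le_exp]; norm_num
    have hζi : w (ζ ^ i - 1 - i * (ζ - 1)) ≤ exp (-(2 : ℤ)) := by
      have h := w.one_add_pow_sub_le (t := ζ - 1) (by rw [hπ, ← exp_zero, exp_le_exp]; omega) i
      rw [hπ, ← exp_nsmul] at h
      simpa using h
    have hx1 : w x ≤ 1 := hx.1.le
    have hxi : w (i * (ζ - 1) * (x - 1)) ≤ exp (-(2 : ℤ)) := by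
      rw [map_mul, map_mul, hπ]
      refine (mul_le_mul' (mul_le_mul' (w.map_natCast_le_one i) le_rfl) hx.2).trans ?_
      rw [one_mul, ← exp_add, exp_le_exp]; norm_num
    have h : ((x * (Units.mk0 ζ (hζ.ne_zero hp.ne_zero)) ^ i : Kˣ) : K) - 1 =
        (x - 1 - n * (ζ - 1)) + (n + i : ℤ) * (ζ - 1) + x * (ζ ^ i - 1 - i * (ζ - 1))
          + i * (ζ - 1) * (x - 1) := by
      push_cast; simp only [Units.val_mk0]; ring
    rw [h]
    refine w.map_add_le (w.map_add_le (w.map_add_le hn' hi') ?_) hxi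
    rw [map_mul]
    exact mul_le_of_le_one_of_le hx1 hζi
  · rw [mul_pow, ← pow_mul, mul_comm i p, pow_mul]
    have : (Units.mk0 ζ (hζ.ne_zero hp.ne_zero)) ^ p = 1 := Units.ext (by simp [hζ.pow_eq_one])
    rw [this, one_pow, mul_one]

/-- The general estimate from level 1 gives only level `p`. Multiplying by a power of `ζ` leaves the
`p`-th power unchanged and moves the base to level 2, which gains one step. -/
theorem pow_prime_mem_higherUnits_succ {x : Kˣ} (hx : x ∈ (v.valuation K).higherUnits 1) :
    x ^ p ∈ (v.valuation K).higherUnits (p + 1) := by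
  have hp : p.Prime := Fact.out
  obtain ⟨y, hy, hyx⟩ := exists_mul_zeta_pow_mem_higherUnits_two hζ hv hx
  rw [← hyx]
  have := hp.two_le
  exact (v.valuation K).pow_prime_mem_higherUnits hp (valuation_natCast_prime_le hζ hv)
    (by omega) (by omega) hy

theorem pow_prime_pow_mem_higherUnits_succ {x : Kˣ} (hx : x ∈ (v.valuation K).higherUnits 1)
    {N : ℕ} (hN : 1 ≤ N) : x ^ p ^ N ∈ (v.valuation K).higherUnits (p + 1) := by
  obtain ⟨n, rfl⟩ := Nat.exists_eq_add_of_le hN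
  rw [pow_add, pow_one, pow_mul]
  exact pow_mem (pow_prime_mem_higherUnits_succ hζ hv hx) _

/-- The first `p`-th power reaches level `p + 1`, the second level `(p - 1) + (p + 1)`. -/
theorem pow_prime_pow_mem_higherUnits_two_mul {x : Kˣ} (hx : x ∈ (v.valuation K).higherUnits 1)
    {N : ℕ} (hN : 2 ≤ N) : x ^ p ^ N ∈ (v.valuation K).higherUnits (2 * p) := by
  have hp : p.Prime := Fact.out
  have := hp.two_le
  obtain ⟨n, rfl⟩ := Nat.exists_eq_add_of_le hN
  rw [pow_add, pow_mul, pow_two, pow_mul]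
  exact pow_mem ((v.valuation K).pow_prime_mem_higherUnits hp (valuation_natCast_prime_le hζ hv)
    (by nlinarith) (by omega) (pow_prime_mem_higherUnits_succ hζ hv hx)) _

-- `σ (ζ - 1) = ζ ^ i - 1` is a multiple of `ζ - 1`, so `σ` cannot lower the order at `𝔭`. Equality
-- follows by using `σ⁻¹` as well.
omit [IsCyclotomicExtension {p} ℚ K] in
theorem valuation_galois_coe_le (σ : K ≃ₐ[ℚ] K) (x : 𝓞 K) :
    v.valuation K (σ x) ≤ v.valuation K x := by
  rcases eq_or_ne x 0 with rfl | hx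
  · simp
  let τ := RingOfIntegers.mapRingHom (σ : K →+* K)
  have hτ : σ x = algebraMap (𝓞 K) K (τ x) := rfl
  have hτζ : hζ.toInteger - 1 ∣ τ (hζ.toInteger - 1) := by
    obtain ⟨i, -, hi⟩ := hζ.eq_pow_of_pow_eq_one (ξ := σ ζ) (by
      rw [← map_pow, hζ.pow_eq_one, map_one])
    have : τ (hζ.toInteger - 1) = hζ.toInteger ^ i - 1 := by
      rw [map_sub, map_one]
      congr 1
      ext
      exact hi.symm
    rw [this]
    exact sub_one_dvd_pow_sub_one _ _
  rw [hτ, v.valuation_of_algebraMap, v.valuation_of_algebraMap,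
    v.intValuation_eq_exp_neg_multiplicity hx, v.intValuation_le_pow_iff_mem]
  have h1 : x ∈ v.asIdeal ^ multiplicity v.asIdeal (Ideal.span {x}) := by
    rw [← v.intValuation_le_pow_iff_mem, v.intValuation_eq_exp_neg_multiplicity hx]
  generalize multiplicity v.asIdeal (Ideal.span {x}) = n at h1 ⊢
  rw [hv, Ideal.span_singleton_pow, Ideal.mem_span_singleton] at h1 ⊢
  obtain ⟨y, rfl⟩ := h1
  rw [map_mul, map_pow]
  exact Dvd.dvd.mul_right (pow_dvd_pow_of_dvd hτζ n) _

omit [IsCyclotomicExtension {p} ℚ K] in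
theorem valuation_galois (σ : K ≃ₐ[ℚ] K) (x : K) :
    v.valuation K (σ x) = v.valuation K x := by
  have h : ∀ x : 𝓞 K, v.valuation K (σ x) = v.valuation K x := by
    refine fun x => le_antisymm (valuation_galois_coe_le hζ hv σ x) ?_
    have := valuation_galois_coe_le hζ hv σ.symm
      (RingOfIntegers.mapRingHom (σ : K →+* K) x)
    simpa using this
  obtain ⟨a, b, hb, rfl⟩ := IsFractionRing.div_surjective (A := 𝓞 K) x
  rw [map_div₀, map_div₀, map_div₀]
  erw [h a, h b]

end Cyclotomic

/-! ### Ramification of Kummer extensions at `𝔭` -/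

section Kummer

open WithZero IsDedekindDomain

/-- A monic integral polynomial with root `(d b - d) / π`, where `b ^ p ≡ 1` modulo `π ^ p` and
`p = u π ^ (p - 1)`; it is of Artin–Schreier type modulo `π`. -/
theorem exists_monic_of_one_add_pow_prime {A : Type*} [CommRing A] [IsDomain A] [CharZero A] {p : ℕ}
    (hp : p.Prime) {π u : A} (hπ : π ≠ 0) (hu : (p : A) = u * π ^ (p - 1)) (d a : A) :
    ∃ g : A[X], g.Monic ∧
      C (π ^ p) * g = (C d + C π * X) ^ p - C (d ^ p + π ^ p * a) ∧
      derivative g = C u * (C d + C π * X) ^ (p - 1) := by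
  obtain ⟨r, hr⟩ := exists_add_pow_prime_eq hp (C d) (C π * X)
  have hp1 : p - 1 + 1 = p := Nat.sub_add_cancel hp.one_le
  have hpc : (p : A[X]) = C u * C π ^ (p - 1) := by
    rw [← C_pow, ← C_mul, ← hu, map_natCast]
  have hpπ : (p : A[X]) * C π = C u * C π ^ p := by
    rw [hpc, mul_assoc, ← pow_succ, hp1]
  have hπp : (C (π ^ p) : A[X]) ≠ 0 := C_ne_zero.2 (pow_ne_zero p hπ)
  have hg : C (π ^ p) * (X ^ p + C u * C d * X * r - C a) =
      (C d + C π * X) ^ p - C (d ^ p + π ^ p * a) := by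
    rw [hr]
    simp only [C_pow, C_mul, C_add, mul_pow]
    linear_combination (-(C d * X * r)) * hpπ
  refine ⟨X ^ p + C u * C d * X * r - C a, ?_, hg, ?_⟩
  · have hl : ((C d + C π * X) ^ p - C (d ^ p + π ^ p * a)).leadingCoeff = π ^ p := by
      have hdeg : (C d + C π * X).degree = 1 := by
        rw [add_comm]; exact degree_linear hπ
      have h0 : (C d + C π * X).leadingCoeff = π := by
        rw [add_comm]; exact leadingCoeff_linear hπ
      rw [sub_eq_add_neg, leadingCoeff_add_of_degree_lt', leadingCoeff_pow, h0]
      rw [← C_neg]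
      refine degree_C_le.trans_lt ?_
      rw [degree_pow, hdeg]
      simpa using hp.pos
    rw [← hg, leadingCoeff_mul, leadingCoeff_C] at hl
    exact mul_left_cancel₀ (pow_ne_zero p hπ) (hl.trans (mul_one _).symm)
  · have h : derivative ((C d + C π * X) ^ p - C (d ^ p + π ^ p * a)) =
        (p : A[X]) * (C d + C π * X) ^ (p - 1) * C π := by
      rw [derivative_sub, derivative_C, derivative_pow]
      simp
    refine mul_left_cancel₀ hπp ?_
    rw [← derivative_C_mul, hg, h, C_pow]
    linear_combination (C d + C π * X) ^ (p - 1) * hpπ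

variable {K : Type*} [Field K] [NumberField K] {L : Type*} [Field L] [NumberField L] [Algebra K L]

/-- A criterion for being unramified: a generator is a simple root, modulo every prime above `𝔭`,
of a polynomial with integral coefficients. -/
theorem isUnramifiedIn_of_derivative_notMem {𝔭 : Ideal (𝓞 K)} {x : 𝓞 L}
    (hx : Algebra.adjoin K {algebraMap (𝓞 L) L x} = ⊤) {g : (𝓞 K)[X]} (hg : aeval x g = 0)
    (h : ∀ 𝔓 : Ideal (𝓞 L), 𝔓.IsPrime → 𝔓.LiesOver 𝔭 → aeval x (derivative g) ∉ 𝔓) :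
    Algebra.IsUnramifiedIn (𝓞 L) 𝔭 := by
  intro 𝔓 h𝔓 h𝔓'
  rw [← not_dvd_differentIdeal_iff, Ideal.dvd_iff_le]
  intro hle
  -- The derivative of the minimal polynomial at `x` lies in the different and divides `g'(x)`,
  -- because `g` is a multiple of the minimal polynomial.
  have hmem := hle (aeval_derivative_mem_differentIdeal (𝓞 K) K L x hx)
  obtain ⟨q, hq⟩ := minpoly.isIntegrallyClosed_dvd (Algebra.IsIntegral.isIntegral (R := 𝓞 K) x) hg
  refine h 𝔓 h𝔓 h𝔓' ?_
  rw [hq, derivative_mul, map_add, map_mul, map_mul, minpoly.aeval, zero_mul, add_zero]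
  exact Ideal.mul_mem_right _ _ hmem

variable {p : ℕ} [Fact p.Prime] [IsCyclotomicExtension {p} ℚ K] {ζ : K}
  (hζ : IsPrimitiveRoot ζ p) {v : HeightOneSpectrum (𝓞 K)}
  (hv : v.asIdeal = Ideal.span {hζ.toInteger - 1})

include hζ hv

-- When `e = 1`, the valuation of `L` at a prime above `𝔭` extends `v` without rescaling. There `b`
-- is a principal unit, so `b ^ p = β` has level `p` in `L`, hence in `K`.
omit [IsCyclotomicExtension {p} ℚ K] in
theorem mem_higherUnits_of_isUnramifiedIn {β : Kˣ} (hβ : β ∈ (v.valuation K).higherUnits 1)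
    {b : L} (hb : b ^ p = algebraMap K L β) (h : Algebra.IsUnramifiedIn (𝓞 L) v.asIdeal) :
    β ∈ (v.valuation K).higherUnits p := by
  have hp : p.Prime := Fact.out
  obtain ⟨⟨P, hP, hPv⟩⟩ := v.asIdeal.nonempty_primesOver (S := 𝓞 L)
  let w : HeightOneSpectrum (𝓞 L) :=
    ⟨P, hP, Ideal.ne_bot_of_liesOver_of_ne_bot v.ne_bot P⟩
  have : w.asIdeal.LiesOver v.asIdeal := hPv
  have he : v.asIdeal.ramificationIdx' w.asIdeal = 1 := by
    rw [Ideal.ramificationIdx'_eq_ramificationIdx _ _ v.ne_bot]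
    exact h.ramificationIdx_eq_one hPv
  have hw : ∀ y : K, w.valuation L (algebraMap K L y) = v.valuation K y := fun y => by
    rw [← HeightOneSpectrum.valuation_liesOver L v w y, he, pow_one]
  have hwp : w.valuation L p ≤ exp (-((p - 1 : ℕ) : ℤ)) := by
    rw [← map_natCast (algebraMap K L), hw]
    exact valuation_natCast_prime_le hζ hv
  have hb0 : b ≠ 0 := by
    rintro rfl
    rw [zero_pow hp.ne_zero, eq_comm, map_eq_zero] at hb
    exact β.ne_zero hb
  have hb1 : Units.mk0 b hb0 ∈ (w.valuation L).higherUnits 1 := by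
    refine (w.valuation L).mem_higherUnits_one_of_pow_prime hp ?_ ?_
    · rw [← map_natCast (algebraMap K L), hw]
      exact valuation_natCast_prime_lt_one hζ hv
    · refine (w.valuation L).mem_higherUnits_of_le le_rfl ?_
      rw [Units.val_pow_eq_pow_val, Units.val_mk0, hb, ← map_one (algebraMap K L), ← map_sub, hw]
      exact hβ.2
  have hbp := (w.valuation L).pow_prime_mem_higherUnits (n := p) hp hwp (by omega)
    (by have := hp.one_le; omega) hb1
  refine ⟨hβ.1, ?_⟩
  have := hbp.2
  rwa [Units.val_pow_eq_pow_val, Units.val_mk0, hb, ← map_one (algebraMap K L), ← map_sub, hw]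
    at this

/-- The substitution `b = 1 + π y / d` turns `b ^ p = β` into an integral equation for `y` whose
derivative is a unit at every prime above `𝔭`. -/
theorem isUnramifiedIn_of_mem_higherUnits {β : Kˣ} (hβ : β ∈ (v.valuation K).higherUnits p)
    {b : L} (hb : b ^ p = algebraMap K L β) (hL : IsSplittingField K L (X ^ p - C (β : K))) :
    Algebra.IsUnramifiedIn (𝓞 L) v.asIdeal := by
  have hp : p.Prime := Fact.out
  obtain ⟨c, hc, d, hd, hdc⟩ := (congrOne_iff_mem_higherUnits hζ hv hp.one_le).2 hβ
  set π := hζ.toInteger - 1 with hπ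
  have hπ0 : π ≠ 0 := hζ.zeta_sub_one_prime'.ne_zero
  rw [hv, Ideal.span_singleton_pow, Ideal.mem_span_singleton] at hc
  obtain ⟨a, rfl⟩ := hc
  obtain ⟨u, hu⟩ := IsCyclotomicExtension.Rat.associated_zeta_sub_one_pow_prime p hζ
  -- From `d β = d + π ^ p a` one gets `(d b) ^ p = d ^ p + π ^ p (d ^ (p-1) a)`.
  obtain ⟨g, hgm, hg, hg'⟩ := exists_monic_of_one_add_pow_prime hp hπ0
    (u := (u : 𝓞 K)) (by rw [← hu, mul_comm]) d (d ^ (p - 1) * a)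
  have hd0 : algebraMap (𝓞 K) L d ≠ 0 := by
    rw [Ne, FaithfulSMul.algebraMap_eq_zero_iff]
    rintro rfl
    exact hd (zero_mem _)
  have hπL : algebraMap (𝓞 K) L π ≠ 0 := by
    rwa [Ne, FaithfulSMul.algebraMap_eq_zero_iff]
  set y : L := algebraMap (𝓞 K) L d * (b - 1) / algebraMap (𝓞 K) L π with hy
  have hdy : algebraMap (𝓞 K) L d + algebraMap (𝓞 K) L π * y = algebraMap (𝓞 K) L d * b := by
    rw [hy]; field_simp; ring
  have hgy : aeval y g = 0 := by
    have h := congrArg (aeval y) hg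
    simp only [map_mul, map_sub, map_pow, map_add, aeval_C, aeval_X] at h
    rw [hdy, mul_pow, hb] at h
    have h' := congrArg (algebraMap K L) hdc
    rw [map_mul, map_sub, map_one] at h'
    change algebraMap K L (algebraMap (𝓞 K) K d) * _ =
      algebraMap K L (algebraMap (𝓞 K) K (π ^ p * a)) at h'
    rw [← IsScalarTower.algebraMap_apply, ← IsScalarTower.algebraMap_apply, map_mul, map_pow] at h'
    have h0 : algebraMap (𝓞 K) L π ^ p * aeval y g = 0 := by
      have hdp : algebraMap (𝓞 K) L d ^ p =
          algebraMap (𝓞 K) L d ^ (p - 1) * algebraMap (𝓞 K) L d := by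
        rw [← pow_succ, Nat.sub_add_cancel hp.one_le]
      rw [h, hdp]
      linear_combination algebraMap (𝓞 K) L d ^ (p - 1) * h'
    exact (mul_eq_zero.1 h0).resolve_left (pow_ne_zero p hπL)
  have hyint : IsIntegral (𝓞 K) y := ⟨g, hgm, hgy⟩
  obtain ⟨x, hx⟩ := (IsIntegralClosure.isIntegral_iff (A := 𝓞 L)).1 hyint
  have hadj : Algebra.adjoin K {algebraMap (𝓞 L) L x} = ⊤ := by
    rw [hx, eq_top_iff, ← hL.adjoin_rootSet, Algebra.adjoin_le_iff]
    have hmem : ∀ z : 𝓞 K, algebraMap (𝓞 K) L z ∈ Algebra.adjoin K {y} := fun z => by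
      rw [IsScalarTower.algebraMap_apply (𝓞 K) K L]
      exact Subalgebra.algebraMap_mem _ _
    have hbmem : b ∈ Algebra.adjoin K {y} := by
      have h : b = algebraMap K L (algebraMap (𝓞 K) K d)⁻¹ *
          (algebraMap (𝓞 K) L d + algebraMap (𝓞 K) L π * y) := by
        rw [hdy, map_inv₀, ← IsScalarTower.algebraMap_apply]
        field_simp
      rw [h]
      exact mul_mem (Subalgebra.algebraMap_mem _ _)
        (add_mem (hmem d) (mul_mem (hmem π) (Algebra.self_mem_adjoin_singleton K y)))
    intro z hz
    have hz' : z ^ p = b ^ p := by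
      have := (mem_rootSet.1 hz).2
      rw [map_sub, map_pow, aeval_X, aeval_C, sub_eq_zero] at this
      rw [this, hb]
    have hb0 : b ≠ 0 := by
      rintro rfl
      rw [zero_pow hp.ne_zero, eq_comm, map_eq_zero] at hb
      exact β.ne_zero hb
    obtain ⟨i, -, hi⟩ := (hζ.map_of_injective (algebraMap K L).injective).eq_pow_of_pow_eq_one
      (ξ := z / b) (by rw [div_pow, hz', div_self (pow_ne_zero p hb0)])
    rw [eq_div_iff hb0] at hi
    rw [← hi, ← map_pow]
    exact mul_mem (Subalgebra.algebraMap_mem _ _) hbmem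
  have hgx : aeval x g = 0 := by
    apply FaithfulSMul.algebraMap_injective (𝓞 L) L
    rw [← aeval_algebraMap_apply, hx, hgy, map_zero]
  refine isUnramifiedIn_of_derivative_notMem hadj hgx fun 𝔓 h𝔓 h𝔓' hmem => ?_
  rw [hg'] at hmem
  simp only [map_mul, map_pow, map_add, aeval_C, aeval_X] at hmem
  -- `g'(x) = u (d + π x) ^ (p-1)` with `u` a unit and `d + π x ≡ d` modulo `𝔓`, while `d ∉ 𝔭`.
  rcases h𝔓.mem_or_mem hmem with h | h
  · exact h𝔓.ne_top (Ideal.eq_top_of_isUnit_mem _ h (u.isUnit.map _))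
  · have hπP : algebraMap (𝓞 K) (𝓞 L) π ∈ 𝔓 := by
      rw [← Ideal.mem_of_liesOver 𝔓 v.asIdeal, hv]
      exact Ideal.mem_span_singleton_self _
    have h1 := (Ideal.add_mem_iff_left 𝔓 (Ideal.mul_mem_right x 𝔓 hπP)).1
      (h𝔓.mem_of_pow_mem _ h)
    rw [← Ideal.mem_of_liesOver 𝔓 v.asIdeal] at h1
    exact hd h1

theorem isPPrimary_iff_mem_higherUnits {β : Kˣ} (hβ : β ∈ (v.valuation K).higherUnits 1) :
    IsPPrimary p v.asIdeal β ↔ β ∈ (v.valuation K).higherUnits p := by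
  have hp : p.Prime := Fact.out
  let F := (X ^ p - C (β : K) : K[X]).SplittingField
  have : NumberField F := NumberField.of_module_finite K F
  obtain ⟨b, hb⟩ : ∃ b : F, b ^ p = algebraMap K F β := by
    obtain ⟨b, hb⟩ := (SplittingField.splits (X ^ p - C (β : K))).exists_eval_eq_zero (by
      rw [degree_map, degree_X_pow_sub_C hp.pos]
      exact_mod_cast hp.ne_zero)
    refine ⟨b, ?_⟩
    simpa [sub_eq_zero] using hb
  exact ⟨fun h => mem_higherUnits_of_isUnramifiedIn (L := F) hζ hv hβ hb h, fun h =>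
    isUnramifiedIn_of_mem_higherUnits (L := F) hζ hv h hb inferInstance⟩

end Kummer

/-! ### The idempotent acting on `K ˣ` -/

section GroupRing

variable {p : ℕ} [Fact p.Prime] {K : Type*} [Field K] [NumberField K]

theorem ApproximatesIdempotent.coeff_eq {θ : (K ≃ₐ[ℚ] K) →* ℤ_[p]} {N : ℕ}
    {e : MonoidAlgebra ℤ (K ≃ₐ[ℚ] K)} (he : ApproximatesIdempotent p K θ N e) :
    ∃ f : (K ≃ₐ[ℚ] K) → ℤ_[p], ∀ s,
      (e.coeff s : ℤ_[p]) = Ring.inverse ((p : ℤ_[p]) - 1) * θ s⁻¹ + (p : ℤ_[p]) ^ N * f s := by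
  classical
  obtain ⟨f, hf⟩ := he
  refine ⟨f.coeff, fun s => ?_⟩
  have h := congrArg (fun x => x.coeff s) hf
  simpa [idempotentOf, MonoidAlgebra.coeff_sum, Finsupp.single_apply] using h

/-- Translation by `σ` acts on the coefficients of `e` as multiplication by `θ(σ)`. -/
theorem ApproximatesIdempotent.exists_coeff_translate {θ : (K ≃ₐ[ℚ] K) →* ℤ_[p]} {N : ℕ}
    {e : MonoidAlgebra ℤ (K ≃ₐ[ℚ] K)} (he : ApproximatesIdempotent p K θ N e) (σ : K ≃ₐ[ℚ] K)
    {a : ℕ} (ha : (p : ℤ_[p]) ^ N ∣ θ σ - a) :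
    ∃ g : (K ≃ₐ[ℚ] K) → ℤ, ∀ s, e.coeff (σ⁻¹ * s) = a * e.coeff s + (p : ℤ) ^ N * g s := by
  obtain ⟨f, hf⟩ := he.coeff_eq
  have h : ∀ s, ∃ g : ℤ, e.coeff (σ⁻¹ * s) - a * e.coeff s = (p : ℤ) ^ N * g := by
    intro s
    -- Divisibility by `p ^ N` is tested in `ℤ_p`, where `θ((σ⁻¹ s)⁻¹) = θ(s⁻¹) θ(σ)`.
    rw [← dvd_def, ← PadicInt.pow_p_dvd_int_iff]
    push_cast
    obtain ⟨c, hc⟩ := ha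
    rw [hf, hf, mul_inv_rev, inv_inv, map_mul]
    refine ⟨Ring.inverse ((p : ℤ_[p]) - 1) * θ s⁻¹ * c + f (σ⁻¹ * s) - a * f s, ?_⟩
    linear_combination (Ring.inverse ((p : ℤ_[p]) - 1) * θ s⁻¹) * hc
  choose g hg using h
  exact ⟨g, fun s => by linear_combination hg s⟩

theorem smul_galoisPow (α : Kˣ) (e : MonoidAlgebra ℤ (K ≃ₐ[ℚ] K)) (σ : K ≃ₐ[ℚ] K) :
    σ • galoisPow α e = ∏ s : K ≃ₐ[ℚ] K, (s • α) ^ e.coeff (σ⁻¹ * s) := by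
  rw [galoisPow, Finset.smul_prod',
    ← Equiv.prod_comp (Equiv.mulLeft σ) fun s => (s • α) ^ e.coeff (σ⁻¹ * s)]
  refine Finset.prod_congr rfl fun s _ => ?_
  rw [smul_zpow', Equiv.coe_mulLeft, inv_mul_cancel_left, mul_smul]

theorem galoisPow_mem {α : Kˣ} {U : Subgroup Kˣ} (hU : ∀ s : K ≃ₐ[ℚ] K, s • α ∈ U)
    (e : MonoidAlgebra ℤ (K ≃ₐ[ℚ] K)) : galoisPow α e ∈ U :=
  prod_mem fun s _ => zpow_mem (hU s) _

/-- `σ e - a e` is divisible by `p ^ N` in `ℤ[G]`, and `z` is `α` raised to the quotient. `U`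
records that `z` inherits the properties shared by the conjugates of `α`. -/
theorem ApproximatesIdempotent.exists_smul_galoisPow_eq {θ : (K ≃ₐ[ℚ] K) →* ℤ_[p]} {N : ℕ}
    {e : MonoidAlgebra ℤ (K ≃ₐ[ℚ] K)} (he : ApproximatesIdempotent p K θ N e) (σ : K ≃ₐ[ℚ] K)
    {a : ℕ} (ha : (p : ℤ_[p]) ^ N ∣ θ σ - a) {α : Kˣ} {U : Subgroup Kˣ}
    (hU : ∀ s : K ≃ₐ[ℚ] K, s • α ∈ U) :
    ∃ z ∈ U, σ • galoisPow α e = galoisPow α e ^ a * z ^ p ^ N := by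
  obtain ⟨g, hg⟩ := he.exists_coeff_translate σ ha
  refine ⟨∏ s : K ≃ₐ[ℚ] K, (s • α) ^ g s, prod_mem fun s _ => zpow_mem (hU s) _, ?_⟩
  rw [smul_galoisPow, galoisPow, ← Finset.prod_pow, ← Finset.prod_pow, ← Finset.prod_mul_distrib]
  refine Finset.prod_congr rfl fun s _ => ?_
  rw [hg, zpow_add, mul_comm (a : ℤ), mul_comm ((p : ℤ) ^ N), zpow_mul, zpow_mul, zpow_natCast,
    ← Nat.cast_pow, zpow_natCast]

variable (p K) in
theorem toZMod_teichmullerChar [IsCyclotomicExtension {p} ℚ K] (s : K ≃ₐ[ℚ] K) :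
    PadicInt.toZMod (teichmullerChar p K s) =
      ((IsCyclotomicExtension.zeta_spec p ℚ K).autToPow ℚ s : (ZMod p)ˣ) := by
  rw [← padicInt_toZMod_eq p (WittVector.constantCoeff.comp
    ((WittVector.equiv p).symm : ℤ_[p] →+* WittVector p (ZMod p)))]
  simp [teichmullerChar, WittVector.teichmuller_coeff_zero]

variable (p K) in
/-- There is an automorphism on which the Teichmüller character has order `p - 1` modulo `p`. -/
theorem exists_toZMod_teichmullerChar_generator [IsCyclotomicExtension {p} ℚ K] :
    ∃ σ : K ≃ₐ[ℚ] K, ∀ m n : ℕ, PadicInt.toZMod (teichmullerChar p K σ) ^ m =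
      PadicInt.toZMod (teichmullerChar p K σ) ^ n → m ≡ n [MOD p - 1] := by
  have hp : p.Prime := Fact.out
  obtain ⟨u, hu⟩ := IsCyclic.exists_ofOrder_eq_natCard (α := (ZMod p)ˣ)
  rw [Nat.card_eq_fintype_card, ZMod.card_units_eq_totient, Nat.totient_prime hp] at hu
  obtain ⟨σ, hσ⟩ := (IsCyclotomicExtension.autEquivPow (n := p) K
    (cyclotomic.irreducible_rat hp.pos)).surjective u
  refine ⟨σ, fun m n h => ?_⟩
  have h1 : PadicInt.toZMod (teichmullerChar p K σ) = (u : ZMod p) := by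
    rw [toZMod_teichmullerChar, ← hσ]
    rfl
  rw [h1, ← Units.val_pow_eq_pow_val, ← Units.val_pow_eq_pow_val, Units.val_inj,
    pow_eq_pow_iff_modEq, hu] at h
  exact h

end GroupRing

/-! ### Galois action on the unit filtration -/

section Filtration

open WithZero IsDedekindDomain

variable {p : ℕ} [Fact p.Prime] {K : Type*} [Field K] [NumberField K]
  [IsCyclotomicExtension {p} ℚ K] {ζ : K} (hζ : IsPrimitiveRoot ζ p)
  {v : HeightOneSpectrum (𝓞 K)} (hv : v.asIdeal = Ideal.span {hζ.toInteger - 1})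

include hζ hv

omit [IsCyclotomicExtension {p} ℚ K] in
theorem smul_mem_higherUnits {k : ℕ} {x : Kˣ} (hx : x ∈ (v.valuation K).higherUnits k)
    (σ : K ≃ₐ[ℚ] K) : σ • x ∈ (v.valuation K).higherUnits k := by
  have h : ((σ • x : Kˣ) : K) = σ x := rfl
  refine ⟨by rw [h, valuation_galois hζ hv, hx.1], ?_⟩
  rw [h, ← map_one σ, ← map_sub, valuation_galois hζ hv]
  exact hx.2

/-- An automorphism raising `ζ` to the power `g` acts on `𝔭 ^ k / 𝔭 ^ (k + 1)` by `g ^ k`. -/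
theorem valuation_galois_sub_pow_mul_le {σ : K ≃ₐ[ℚ] K} {g : ℕ} (hg : σ ζ = ζ ^ g) {k : ℕ} {t : K}
    (ht : v.valuation K t ≤ exp (-(k : ℤ))) :
    v.valuation K (σ t - g ^ k * t) ≤ exp (-((k + 1 : ℕ) : ℤ)) := by
  have hp : p.Prime := Fact.out
  set w := v.valuation K
  have hπ : w (ζ - 1) = exp (-1 : ℤ) := valuation_zeta_sub_one hζ hv
  have hπ0 : ζ - 1 ≠ 0 := hζ.sub_one_ne_zero hp.one_lt
  have hπk : w ((ζ - 1) ^ k) = exp (-(k : ℤ)) := by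
    rw [map_pow, hπ, ← exp_nsmul]; simp
  obtain ⟨c, hc, rfl⟩ : ∃ c : K, w c ≤ 1 ∧ t = (ζ - 1) ^ k * c := by
    refine ⟨t / (ζ - 1) ^ k, ?_, by field_simp⟩
    rw [map_div₀, hπk]
    exact div_le_one_of_le₀ ht zero_le
  obtain ⟨s, hs, hs'⟩ : ∃ s : K, w (s - g) < 1 ∧ σ (ζ - 1) = (ζ - 1) * s := by
    refine ⟨σ (ζ - 1) / (ζ - 1), ?_, by field_simp⟩
    have h : σ (ζ - 1) / (ζ - 1) - g = (ζ ^ g - 1 - g * (ζ - 1)) / (ζ - 1) := by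
      rw [map_sub, map_one, hg]; field_simp
    have h2 := w.one_add_pow_sub_le (t := ζ - 1) (by rw [hπ, ← exp_zero, exp_le_exp]; omega) g
    rw [add_sub_cancel] at h2
    rw [h, map_div₀, hπ]
    refine (div_le_div_of_nonneg_right h2 zero_le).trans_lt ?_
    rw [hπ, pow_two, mul_div_cancel_right₀ _ exp_ne_zero, ← exp_zero, exp_lt_exp]
    omega
  have hs1 : w s ≤ 1 := by
    have := w.map_add_le hs.le (w.map_natCast_le_one g)
    simpa using this
  have hsk : w (s ^ k - g ^ k) < 1 := by
    rw [← geom_sum₂_mul, map_mul, mul_comm]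
    refine mul_lt_one_of_lt_of_le hs (w.map_sum_le fun i _ => ?_)
    rw [map_mul, map_pow, map_pow]
    exact mul_le_one' (pow_le_one' hs1 _) (pow_le_one' (w.map_natCast_le_one g) _)
  -- `σ` acts trivially on the residue field: `c` is congruent to an integer, which `σ` fixes.
  have hσc : w (σ c - c) < 1 := by
    obtain ⟨n, hn⟩ := exists_intCast_valuation_sub_lt_one hζ hv hc
    have h : σ c - c = σ (c - n) - (c - n) := by rw [map_sub, map_intCast]; ring
    rw [h]
    exact w.map_sub_lt (by rwa [valuation_galois hζ hv]) hn
  have h : σ ((ζ - 1) ^ k * c) - g ^ k * ((ζ - 1) ^ k * c) =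
      (ζ - 1) ^ k * ((s ^ k - g ^ k) * σ c + g ^ k * (σ c - c)) := by
    rw [map_mul, map_pow, hs', mul_pow]; ring
  have h1 : w ((s ^ k - g ^ k) * σ c + g ^ k * (σ c - c)) < 1 := by
    refine w.map_add_lt ?_ ?_
    · rw [map_mul]
      exact mul_lt_one_of_lt_of_le hsk (by rwa [valuation_galois hζ hv])
    · rw [map_mul, map_pow, mul_comm]
      exact mul_lt_one_of_lt_of_le hσc (pow_le_one' (w.map_natCast_le_one g) _)
  rw [h, map_mul, hπk]
  refine (mul_le_mul_right (w.lt_one_iff_le_exp_neg_one.1 h1) _).trans ?_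
  rw [← exp_add, exp_le_exp]
  push_cast
  omega

/-- On `U_k / U_{k+1}`, `σ` multiplies the class of `β - 1` by `g ^ k`, whereas the relation makes
it multiply by `a`. As `g ^ k - a` is invertible modulo `p`, the class vanishes. -/
theorem mem_higherUnits_succ_of_smul_eq {σ : K ≃ₐ[ℚ] K} {g : ℕ} (hg : σ ζ = ζ ^ g) {k a : ℕ}
    (hk : 1 ≤ k) (hga : ¬ (p : ℤ) ∣ (g : ℤ) ^ k - a) {β z : Kˣ}
    (hβ : β ∈ (v.valuation K).higherUnits k) (hz : z ∈ (v.valuation K).higherUnits (k + 1))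
    (h : σ • β = β ^ a * z) : β ∈ (v.valuation K).higherUnits (k + 1) := by
  set w := v.valuation K
  refine ⟨hβ.1, ?_⟩
  have ht := hβ.2
  have ht1 : w ((β : K) - 1) ≤ 1 := ht.trans (by rw [← exp_zero, exp_le_exp]; omega)
  have h1 := valuation_galois_sub_pow_mul_le hζ hv hg ht
  have h2 : w ((β : K) ^ a - 1 - a * ((β : K) - 1)) ≤ exp (-((k + 1 : ℕ) : ℤ)) := by
    have := w.one_add_pow_sub_le ht1 a
    rw [add_sub_cancel] at this
    -- The quadratic error has order at least `2k`, and `2k ≥ k + 1` because `k ≥ 1`.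
    refine this.trans ((pow_le_pow_left' ht 2).trans ?_)
    rw [← exp_nsmul, exp_le_exp]
    push_cast
    rw [nsmul_eq_mul]
    push_cast
    omega
  have h3 : w ((β : K) ^ a * (z - 1)) ≤ exp (-((k + 1 : ℕ) : ℤ)) := by
    rw [map_mul, map_pow, hβ.1, one_pow, one_mul]
    exact hz.2
  have h' : σ (β : K) = (β : K) ^ a * z := by
    have := congrArg Units.val h
    simpa using this
  have h4 : ((g : ℤ) ^ k - a : ℤ) * ((β : K) - 1) =
      (β : K) ^ a * (z - 1) + ((β : K) ^ a - 1 - a * ((β : K) - 1))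
        - (σ ((β : K) - 1) - g ^ k * ((β : K) - 1)) := by
    rw [map_sub, map_one, h']; push_cast; ring
  have h5 : w (((g : ℤ) ^ k - a : ℤ) : K) = 1 := by
    refine le_antisymm (w.map_intCast_le_one _) (le_of_not_gt fun hlt => hga ?_)
    exact (valuation_intCast_lt_one_iff hζ hv _).1 hlt
  rw [← one_mul (w ((β : K) - 1)), ← h5, ← map_mul, h4]
  exact w.map_sub_le (w.map_add_le h3 h2) h1

-- The normalization of `β` forces `x ^ (p ^ N)`, hence `x`, to be a principal unit. The change of
-- representative then only multiplies `z` by the principal unit `σ x * x ^ (-a)`.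
omit [IsCyclotomicExtension {p} ℚ K] in
theorem IsThetaComponent.exists_smul_eq {θ : (K ≃ₐ[ℚ] K) →* ℤ_[p]} {N : ℕ} {α β : Kˣ}
    (h : IsThetaComponent p θ N α β) (hα : α ∈ (v.valuation K).higherUnits 1)
    (hβ : β ∈ (v.valuation K).higherUnits 1) (σ : K ≃ₐ[ℚ] K)
    {a : ℕ} (ha : (p : ℤ_[p]) ^ N ∣ θ σ - a) :
    ∃ z ∈ (v.valuation K).higherUnits 1, σ • β = β ^ a * z ^ p ^ N := by
  obtain ⟨e, he, x, rfl⟩ := h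
  have hU : ∀ s : K ≃ₐ[ℚ] K, s • α ∈ (v.valuation K).higherUnits 1 :=
    smul_mem_higherUnits hζ hv hα
  have hx : x ∈ (v.valuation K).higherUnits 1 :=
    (v.valuation K).mem_higherUnits_one_of_pow_prime_pow Fact.out
      (valuation_natCast_prime_lt_one hζ hv)
      ((Subgroup.mul_mem_cancel_left _ (galoisPow_mem hU e)).1 hβ)
  obtain ⟨z, hz, hze⟩ := he.exists_smul_galoisPow_eq σ ha hU
  refine ⟨z * (σ • x) * (x ^ a)⁻¹, mul_mem (mul_mem hz (smul_mem_higherUnits hζ hv hx σ))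
    (inv_mem (pow_mem hx a)), ?_⟩
  rw [smul_mul', hze, smul_pow', mul_pow _ _ a, mul_pow _ _ (p ^ N), mul_pow _ _ (p ^ N), inv_pow,
    ← pow_mul x, ← pow_mul x, mul_comm a, mul_comm (_ * _) (_)⁻¹, mul_assoc _ (x ^ _),
    mul_inv_cancel_left, mul_assoc]

/-- Tested on a `σ` with `ω(σ)` of order `p - 1` mod `p`, the characters `ω ^ k` and `ω ^ m` differ
modulo `p` unless `k ≡ m`. `M` is the level below which the `p ^ N`-th power is invisible. -/
theorem IsThetaComponent.mem_higherUnits_succ {m N : ℕ} (hN : 1 ≤ N) {α β : Kˣ}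
    (h : IsThetaComponent p (teichmullerChar p K ^ m) N α β)
    (hα : α ∈ (v.valuation K).higherUnits 1) {k M : ℕ} (hk : 1 ≤ k) (hkM : k + 1 ≤ M)
    (hM : ∀ x ∈ (v.valuation K).higherUnits 1, x ^ p ^ N ∈ (v.valuation K).higherUnits M)
    (hkm : ¬ k ≡ m [MOD p - 1]) (hβ : β ∈ (v.valuation K).higherUnits k) :
    β ∈ (v.valuation K).higherUnits (k + 1) := by
  obtain ⟨σ, hσ⟩ := exists_toZMod_teichmullerChar_generator p K
  -- A natural number congruent to `θ(σ)` modulo `p ^ N`.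
  set a := ((teichmullerChar p K ^ m) σ).appr N
  have ha : (p : ℤ_[p]) ^ N ∣ (teichmullerChar p K ^ m) σ - a := by
    rw [← Ideal.mem_span_singleton]
    exact PadicInt.appr_spec N _
  obtain ⟨z, hz, he⟩ := h.exists_smul_eq hζ hv hα ((v.valuation K).higherUnits_anti hk hβ) σ ha
  refine mem_higherUnits_succ_of_smul_eq hζ hv (teichmullerChar_spec p K σ ζ hζ.pow_eq_one) hk
    (fun hd => hkm (hσ _ _ ?_)) hβ ((v.valuation K).higherUnits_anti hkM (hM z hz)) he
  have ha' : PadicInt.toZMod (teichmullerChar p K σ) ^ m = a := by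
    obtain ⟨c, hc⟩ := (dvd_pow_self (p : ℤ_[p]) (by omega : N ≠ 0)).trans ha
    have := congrArg PadicInt.toZMod hc
    rw [map_sub, map_mul, map_natCast, map_natCast, ZMod.natCast_self, zero_mul, sub_eq_zero]
      at this
    rw [← this, MonoidHom.pow_apply, map_pow]
  rw [ha', ← sub_eq_zero]
  rw [← ZMod.intCast_zmod_eq_zero_iff_dvd] at hd
  simpa only [Int.cast_sub, Int.cast_pow, Int.cast_natCast, ZMod.natCast_zmod_val] using hd

theorem IsThetaComponent.mem_higherUnits_add {m N : ℕ} (hN : 1 ≤ N) {α β : Kˣ}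
    (h : IsThetaComponent p (teichmullerChar p K ^ m) N α β)
    (hα : α ∈ (v.valuation K).higherUnits 1) {k j M : ℕ} (hk : 1 ≤ k) (hkM : k + j ≤ M)
    (hM : ∀ x ∈ (v.valuation K).higherUnits 1, x ^ p ^ N ∈ (v.valuation K).higherUnits M)
    (hkm : ∀ i < j, ¬ k + i ≡ m [MOD p - 1]) (hβ : β ∈ (v.valuation K).higherUnits k) :
    β ∈ (v.valuation K).higherUnits (k + j) := by
  induction j with
  | zero => exact hβ
  | succ j ih =>
    exact h.mem_higherUnits_succ hζ hv hN hα (k := k + j) (by omega) hkM hM (hkm j (by omega))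
      (ih (by omega) fun i hi => hkm i (by omega))

end Filtration
theorem proposition2p4 (p : ℕ) [Fact p.Prime]
    (K : Type*) [Field K] [NumberField K] [IsCyclotomicExtension {p} ℚ K]
    (𝔭 : Ideal (𝓞 K)) [𝔭.IsPrime] (h𝔭 : (p : 𝓞 K) ∈ 𝔭)
    (α : Kˣ) (hα : CongrOne 𝔭 𝔭 α)
    (m : ℕ) (hm : 2 ≤ m) (hm' : m ≤ p - 2) :
    𝔭 ^ (m + p - 1) = Ideal.span {(p : 𝓞 K)} * 𝔭 ^ m ∧
    ∀ N : ℕ, 1 ≤ N →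
      (∀ e : MonoidAlgebra ℤ (K ≃ₐ[ℚ] K),
        ApproximatesIdempotent p K (teichmullerChar p K ^ m) N e →
          CongrOne 𝔭 𝔭 (galoisPow α e)) ∧
      ∀ β : Kˣ, IsThetaComponent p (teichmullerChar p K ^ m) N α β → CongrOne 𝔭 𝔭 β →
        CongrOne 𝔭 (𝔭 ^ m) β ∧
        (IsPPrimary p 𝔭 β ↔ CongrOne 𝔭 (Ideal.span {(p : 𝓞 K)}) β) ∧
        (2 ≤ N ∨ m = 2 → IsPPrimary p 𝔭 β → CongrOne 𝔭 (𝔭 ^ (m + p - 1)) β) := by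
  have hζ := IsCyclotomicExtension.zeta_spec p ℚ K
  have h𝔭π := eq_span_zeta_sub_one_of_natCast_mem hζ 𝔭 h𝔭
  have h𝔭0 : 𝔭 ≠ ⊥ := by
    rw [h𝔭π, Ne, Ideal.span_singleton_eq_bot]
    exact hζ.zeta_sub_one_prime'.ne_zero
  obtain ⟨v, rfl⟩ : ∃ v : IsDedekindDomain.HeightOneSpectrum (𝓞 K), v.asIdeal = 𝔭 :=
    ⟨⟨𝔭, inferInstance, h𝔭0⟩, rfl⟩
  have hspan := span_natCast_eq_pow hζ h𝔭π
  have hone : ∀ x : Kˣ, CongrOne v.asIdeal v.asIdeal x ↔ x ∈ (v.valuation K).higherUnits 1 :=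
    fun x => by simpa using congrOne_iff_mem_higherUnits hζ h𝔭π le_rfl (x := x)
  rw [hone] at hα
  have hmod : ∀ k, m < k → k < m + (p - 1) → ¬ k ≡ m [MOD p - 1] := fun k h1 h2 h => by
    have := Nat.le_of_dvd (by omega) ((Nat.modEq_iff_dvd' h1.le).1 h.symm)
    omega
  refine ⟨by rw [hspan, ← pow_add]; congr 1; omega, fun N hN => ⟨fun e _ => ?_, ?_⟩⟩
  · rw [hone]
    exact galoisPow_mem (smul_mem_higherUnits hζ h𝔭π hα) e
  intro β hβθ hβ
  rw [hone] at hβ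
  have hM : ∀ x ∈ (v.valuation K).higherUnits 1,
      x ^ p ^ N ∈ (v.valuation K).higherUnits (p + 1) :=
    fun x hx => pow_prime_pow_mem_higherUnits_succ hζ h𝔭π hx hN
  rw [isPPrimary_iff_mem_higherUnits hζ h𝔭π hβ, hspan,
    congrOne_iff_mem_higherUnits hζ h𝔭π (by omega), congrOne_iff_mem_higherUnits hζ h𝔭π (by omega),
    congrOne_iff_mem_higherUnits hζ h𝔭π (by omega)]
  refine ⟨?_, ⟨fun h => (v.valuation K).higherUnits_anti (by omega) h, fun h => ?_⟩, ?_⟩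
  -- The levels `1, …, m - 1` are distinct from `m` and all lie below `p - 1`, so none is congruent
  -- to `m`.
  · have := hβθ.mem_higherUnits_add hζ h𝔭π hN hα (j := m - 1) le_rfl (by omega) hM
      (fun i hi h => by
        have := Nat.ModEq.eq_of_lt_of_lt h (by omega) (by omega)
        omega) hβ
    rwa [Nat.add_sub_cancel' (by omega)] at this
  -- Level `p - 1` lies strictly between `m` and `m + p - 1`, so a unit congruent to 1 modulo `p`
  -- rises to level `p`.
  · have := hβθ.mem_higherUnits_succ hζ h𝔭π hN hα (by omega) (by omega) hM
      (hmod _ (by omega) (by omega)) h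
    rwa [Nat.sub_add_cancel (by omega)] at this
  · intro hNm h
    -- For `N ≥ 2` the level `2p` exceeds `m + p - 1`; for `m = 2` the target is exactly `p + 1`,
    -- which `N = 1` already provides.
    obtain ⟨M, hmM, hM'⟩ : ∃ M, m + p - 1 ≤ M ∧ ∀ x ∈ (v.valuation K).higherUnits 1,
        x ^ p ^ N ∈ (v.valuation K).higherUnits M := by
      rcases hNm with hN2 | rfl
      · exact ⟨2 * p, by omega, fun x hx => pow_prime_pow_mem_higherUnits_two_mul hζ h𝔭π hx hN2⟩
      · exact ⟨p + 1, by omega, hM⟩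
    have := hβθ.mem_higherUnits_add hζ h𝔭π hN hα (k := p) (j := m - 1) (by omega) (by omega) hM'
      (fun i hi => hmod _ (by omega) (by omega)) h
    rwa [show p + (m - 1) = m + p - 1 by omega] at this
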